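/- **Setting.** Let $Q\in\mathbb{R}^{n\times n}$ be symmetric positive definite with $Q_{ij}\le 0$ for $i\ne j$, let $0<\alpha$ and $L$ satisfy $\alpha I\preccurlyeq Q\preccurlyeq L I$, let $b\in\mathbb{R}^n$, $c\in\mathbb{R}$, $\epsilon>0$, and let $g(x)=\tfrac12\langle x,Qx\rangle-\langle b,x\rangle+c$. Put $\kappa=L/\alpha$ and $x^*=\operatorname{argmin}_{x\in\mathbb{R}^n_{\ge 0}}g(x)$. For $S\subseteq[n]$ let $C(S)=\operatorname{span}\{e_i : i\in S\}\cap\mathbb{R}^n_{\ge0}$. Inequalities between vectors are coordinatewise, $\operatorname{supp}(x)=\{i : x_i\neq 0\}$, and an $\epsilon$-minimizer of $g$ is a point $x\in\mathbb{R}^n_{\ge0}$ with $g(x)-g(x^*)\le\epsilon$. **Subroutine.** For a closed convex set $C$, $x_0\in C$, a function $f$ and $N\ge1$, let $\mathrm{APGD}(C,x_0,f,N)=y_N$, where $y_0=z_0=x_0$, $A_0=0$, $a_0=1$ and, for $k\ge0$, $$A_{k+1}=A_k+a_k,\qquad x_{k+1}=\tfrac{A_k}{A_{k+1}}y_k+\tfrac{a_k}{A_{k+1}}z_k,$$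 $$z_{k+1}=\mathrm{Proj}_C\Big(\tfrac{\kappa-1+A_k}{\kappa-1+A_{k+1}}z_k+\tfrac{a_k}{\kappa-1+A_{k+1}}\big(x_{k+1}-\tfrac1\alpha\nabla f(x_{k+1})\big)\Big),$$ $$y_{k+1}=\tfrac{A_k}{A_{k+1}}y_k+\tfrac{a_k}{A_{k+1}}z_{k+1},\qquad a_{k+1}=A_{k+1}\Big(\tfrac{2\kappa}{2\kappa+1-\sqrt{1+4\kappa}}-1\Big).$$ **Algorithm ASPR.** Let $S^{(-1)}=\emptyset$, $x^{(0)}=0$ and $S^{(0)}=\{i : \nabla_i g(x^{(0)})<0\}$. For $t=0,1,\dots$, as long as $S^{(t)}\ne S^{(t-1)}$, set $$\delta_t=\sqrt{\frac{\epsilon\alpha}{(1+|S^{(t)}|)L^2}},\qquad \hat\epsilon_t=\frac{\delta_t^2\alpha}{2},$$ $$N_t=\max\Big\{1,\;1+\Big\lceil 2\sqrt{\kappa}\,\log\frac{(L-\alpha)\sum_{i\in S^{(t)}}(\nabla_i g(x^{(t)}))^2}{2\hat\epsilon_t\alpha^2}\Big\rceil\Big\}$$ (with $N_t=1$ if the argument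 of the logarithm is $0$), $$\bar x^{(t+1)}=\mathrm{APGD}\big(C(S^{(t)}),x^{(t)},g,N_t\big),\qquad x^{(t+1)}_i=\max\{0,\bar x^{(t+1)}_i-\delta_t\}\ \ (i\in[n]),$$ $$S^{(t+1)}=S^{(t)}\cup\{i : \nabla_i g(x^{(t+1)})<0\}.$$ The output is $x^{(T)}$, where $T\ge0$ is the first index with $S^{(T)}=S^{(T-1)}$. Let $x^{(*,-1)}=x^{(*,0)}=0$ and $x^{(*,t)}=\operatorname{argmin}_{x\in C(S^{(t-1)})}g(x)$ for $1\le t\le T$. **Theorem.** The minimizer $x^*$ exists and is unique, the algorithm stops (such a $T$ exists), and for every $t\in\{0,1,\dots,T\}$ the point $x^{(*,t)}$ is the unique minimizer of $g$ over $C(S^{(t-1)})$ and the following hold. 1. $x^{(*,t)}_i>0$ if and only if $i\in S^{(t-1)}$, and $\nabla_i g(x^{(*,t)})=0$ for all $i\in S^{(t-1)}$. 2. $x^{(t)}\le x^{(*,t)}\le x^*$ and $x^{(*,t-1)}\le x^{(*,t)}$. 3. $S^{(t)}\subseteq\operatorname{supp}(x^*)$, and either $S^{(t-1)}\subsetneq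 S^{(t)}$ or $x^{(t)}$ is an $\epsilon$-minimizer of $g$. In particular, the output $x^{(T)}$ is an $\epsilon$-minimizer of $g$: $x^{(T)}\in\mathbb{R}^n_{\ge0}$ and $g(x^{(T)})-g(x^*)\le\epsilon$. -/

import Mathlib

noncomputable section

namespace ASPR

/-- `ℝⁿ` with the Euclidean norm. -/
abbrev E (n : ℕ) : Type := EuclideanSpace ℝ (Fin n)

/-- `x` is a minimizer of `f` over `C`. -/
def IsArgminOn {n : ℕ} (f : E n → ℝ) (C : Set (E n)) (x : E n) : Prop :=
  x ∈ C ∧ ∀ y ∈ C, f x ≤ f y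

/-- A minimizer of `f` over `C` (meaningful when there is one). -/
def argminOn {n : ℕ} (f : E n → ℝ) (C : Set (E n)) : E n :=
  Classical.epsilon (IsArgminOn f C)

/-- `x` is an `ε`-minimizer of `f` over `C`. -/
def IsEpsMinOn {n : ℕ} (f : E n → ℝ) (C : Set (E n)) (ε : ℝ) (x : E n) : Prop :=
  x ∈ C ∧ ∀ y ∈ C, f x - f y ≤ ε

/-- Euclidean projection of `x` onto `C`. -/
def proj {n : ℕ} (C : Set (E n)) (x : E n) : E n :=
  argminOn (fun y => ‖x - y‖) C

/-- The nonnegative orthant. -/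
def orthant (n : ℕ) : Set (E n) := {x | ∀ i, 0 ≤ x i}

/-- The cone `span {e_i | i ∈ S} ∩ ℝⁿ_{≥ 0}`. -/
def face {n : ℕ} (S : Finset (Fin n)) : Set (E n) :=
  (Submodule.span ℝ {v | ∃ i ∈ S, v = EuclideanSpace.single i (1 : ℝ)} : Set (E n)) ∩ orthant n

/-- The support of a vector. -/
def supp {n : ℕ} (x : E n) : Finset (Fin n) := {i | x i ≠ 0}

/-- The quadratic `x ↦ ½ ⟨x, Q x⟩ - ⟨b, x⟩ + c`. -/
def quad {n : ℕ} (Q : Matrix (Fin n) (Fin n) ℝ) (b : E n) (c : ℝ) (x : E n) : ℝ :=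
  1 / 2 * dotProduct x.ofLp (Q.mulVec x.ofLp) - dotProduct b.ofLp x.ofLp + c

/-- The quantities `y_t, z_t, A_t, a_t` carried by accelerated projected gradient descent. -/
structure APGDState (n : ℕ) where
  y : E n
  z : E n
  A : ℝ
  a : ℝ

/-- One iteration of accelerated projected gradient descent. -/
def apgdStep {n : ℕ} (C : Set (E n)) (f : E n → ℝ) (α L : ℝ) (s : APGDState n) : APGDState n :=
  let κ := L / α
  let A' := s.A + s.a
  let x' := (s.A / A') • s.y + (s.a / A') • s.z
  let z' := proj C (((κ - 1 + s.A) / (κ - 1 + A')) • s.z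
    + (s.a / (κ - 1 + A')) • (x' - (1 / α) • gradient f x'))
  let y' := (s.A / A') • s.y + (s.a / A') • z'
  { y := y'
    z := z'
    A := A'
    a := A' * (2 * κ / (2 * κ + 1 - √(1 + 4 * κ)) - 1) }

/-- `APGD(C, x₀, f, N)`: the point `y_N` after `N` iterations started at `x₀`. -/
def apgd {n : ℕ} (C : Set (E n)) (x₀ : E n) (f : E n → ℝ) (α L : ℝ) (N : ℕ) : E n :=
  ((apgdStep C f α L)^[N] { y := x₀, z := x₀, A := 0, a := 1 }).y

/-- The retraction parameter `δ_t` as a function of the current index set. -/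
def delta {n : ℕ} (α L ε : ℝ) (S : Finset (Fin n)) : ℝ :=
  √(ε * α / ((1 + (S.card : ℝ)) * L ^ 2))

/-- The accuracy parameter of the subproblem as a function of the current index set. -/
def epsHat {n : ℕ} (α L ε : ℝ) (S : Finset (Fin n)) : ℝ :=
  delta α L ε S ^ 2 * α / 2

/-- Number of iterations of the subroutine. The natural-number ceiling is `0` on negative reals,
so this is `max {1, 1 + ⌈2 √κ log (⋯)⌉}`; it is `1` if the argument of the logarithm vanishes. -/
def numIter {n : ℕ} (g : E n → ℝ) (α L ε : ℝ) (x : E n) (S : Finset (Fin n)) : ℕ :=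
  1 + ⌈2 * √(L / α) *
    Real.log ((L - α) * (∑ i ∈ S, (gradient g x i) ^ 2) / (2 * epsHat α L ε S * α ^ 2))⌉₊

/-- The coordinates at which the gradient is negative. -/
def negCoords {n : ℕ} (g : E n → ℝ) (x : E n) : Finset (Fin n) := {i | gradient g x i < 0}

/-- The next iterate: run the subroutine over `face S` from `x`, then pull towards `0`. -/
def nextIter {n : ℕ} (g : E n → ℝ) (α L ε : ℝ) (x : E n) (S : Finset (Fin n)) : E n :=
  let xbar := apgd (face S) x g α L (numIter g α L ε x S)
  WithLp.toLp 2 (fun i => max 0 (xbar i - delta α L ε S))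

/-- The pair `(x^{(t)}, S^{(t)})` of the accelerated sparse PageRank algorithm; its while-loop
is left at the first `t` with `S^{(t)} = S^{(t-1)}`. -/
def run {n : ℕ} (g : E n → ℝ) (α L ε : ℝ) : ℕ → E n × Finset (Fin n)
  | 0 => (0, negCoords g 0)
  | t + 1 =>
    let x := (run g α L ε t).1
    let S := (run g α L ε t).2
    let x' := nextIter g α L ε x S
    (x', S ∪ negCoords g x')

/-- The iterate `x^{(t)}`. -/
def iter {n : ℕ} (g : E n → ℝ) (α L ε : ℝ) (t : ℕ) : E n := (run g α L ε t).1

/-- The set of known good indices `S^{(t)}`. -/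
def known {n : ℕ} (g : E n → ℝ) (α L ε : ℝ) (t : ℕ) : Finset (Fin n) := (run g α L ε t).2

/-- `S^{(t-1)}`, with `S^{(-1)} = ∅`. -/
def knownPrev {n : ℕ} (g : E n → ℝ) (α L ε : ℝ) : ℕ → Finset (Fin n)
  | 0 => ∅
  | t + 1 => known g α L ε t

/-- The restricted minimizer `x^{(*,t)}`: the minimizer over the cone of `S^{(t-1)}`,
with `x^{(*,0)} = 0`. -/
def restrMin {n : ℕ} (g : E n → ℝ) (α L ε : ℝ) : ℕ → E n
  | 0 => 0
  | t + 1 => argminOn g (face (known g α L ε t))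

/-- `x^{(*,t-1)}`, with `x^{(*,-1)} = 0`. -/
def restrMinPrev {n : ℕ} (g : E n → ℝ) (α L ε : ℝ) : ℕ → E n
  | 0 => 0
  | t + 1 => restrMin g α L ε t

end ASPR

end

/-!
The restricted problems are solved by accelerated projected gradient descent, and the sets found by
the outer loop are controlled by the sign pattern of `Q`.

*Inner loop.* The projection step minimizes a quadratic lower model of `g` plus a proximal term, so
the potential `A (g y - g u) + α (κ - 1 + A) / 2 * ‖z - u‖²` does not increase (`potential_step`);
the choice of the step sizes makes `A` grow geometrically with ratio at least `exp (1 / (2 √κ))`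
(`exp_le_growth`). Since the restricted minimizer `w` is stationary on the index set `S`, the
initial distance is at most `α⁻¹` times the norm of the gradient on `S`, and the prescribed number
of iterations brings the inner solution within `δ` of `w` (`apgd_numIter`). Subtracting `δ` and
truncating at `0` then gives a point below `w`, whose squared distance to `w` is at most
`2 (1 + |S|) δ²` (`nextIter_spec`).

*Outer loop.* Because the off-diagonal entries of `Q` are nonpositive, increasing other coordinates
can only decrease the gradient at a given coordinate (`grad_anti`), and a point `v` whose gradient is
nonpositive on its support lies below every nonnegative point whose gradient is nonnegative there
(`le_of_grad`). Since `x^{(t)}` lies below the restricted minimizer `x^{(*,t)}`, an index with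
negative gradient at `x^{(t)}` which is not yet known has negative gradient at `x^{(*,t)}`. Hence
`x^{(*,t)}` is a subsolution of the next restricted problem, whose minimizer is therefore larger,
positive exactly on the known indices and stationary there (`argmin_face_of_subsolution`); the same
comparison with the global minimizer shows that only indices of its support are ever found.

*Stopping.* If no new index is found, the gradient at `x^{(t)}` is nonnegative off the known set,
and on it the gradient is at most `L` times the distance to `x^{(*,t)}`; strong convexity bounds the
gap by `L² * ‖x^{(t)} - x^{(*,t)}‖² / (2 α) ≤ ε` (`gap_le`). As the index sets grow inside a finite
set, this happens eventually.
-/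

namespace ASPR

open scoped RealInnerProductSpace

/-! ### One iteration of accelerated projected gradient descent -/

section Accelerated

variable {F : Type*} [NormedAddCommGroup F] [InnerProductSpace ℝ F]

/-- The potential does not increase in one step. Here `y'`, `z'` and `A'` are the updated values of
`y`, `z` and `A`; `hproj` is the optimality condition of `z'` against `u`, and `hcoef` is the only
requirement on the step size `a`. -/
theorem potential_step {α κ A a A' fx fy fy' fu : ℝ} {x y z y' z' u G : F}
    (hα : 0 < α) (hκ : 1 ≤ κ) (hA : 0 ≤ A) (ha : 0 < a) (hA' : A' = A + a)
    (hcoef : (κ - 1) * a ^ 2 ≤ (κ - 1 + A) * A')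
    (hx : x = (A / A') • y + (a / A') • z) (hy' : y' = (A / A') • y + (a / A') • z')
    (hfy : fx + ⟪G, y - x⟫ + α / 2 * ‖y - x‖ ^ 2 ≤ fy)
    (hfu : fx + ⟪G, u - x⟫ + α / 2 * ‖u - x‖ ^ 2 ≤ fu)
    (hfy' : fy' ≤ fx + ⟪G, y' - x⟫ + κ * α / 2 * ‖y' - x‖ ^ 2)
    (hproj : ⟪((κ - 1 + A) / (κ - 1 + A')) • z + (a / (κ - 1 + A')) • (x - (1 / α) • G) - z',
      u - z'⟫ ≤ 0) :
    A' * (fy' - fu) + α * (κ - 1 + A') / 2 * ‖z' - u‖ ^ 2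
      ≤ A * (fy - fu) + α * (κ - 1 + A) / 2 * ‖z - u‖ ^ 2 := by
  have hA'0 : 0 < A' := by linarith
  have hB : 0 < κ - 1 + A' := by linarith
  -- write everything relative to `x`, the barycentre of `y` and `z` with weights `A` and `a`
  have hpr : A • (y - x) + a • (z - x) = 0 := by
    have h1 : A' • x = A • y + a • z := by
      rw [hx, smul_add, smul_smul, smul_smul, mul_div_cancel₀ _ hA'0.ne',
        mul_div_cancel₀ _ hA'0.ne']
    rw [hA', add_smul] at h1
    rw [smul_sub, smul_sub, sub_add_sub_comm, ← h1, sub_self]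
  have he : A' • (y' - x) = A • (y - x) + a • (z' - x) := by
    have h1 : A' • y' = A • y + a • z' := by
      rw [hy', smul_add, smul_smul, smul_smul, mul_div_cancel₀ _ hA'0.ne',
        mul_div_cancel₀ _ hA'0.ne']
    rw [smul_sub, h1, hA', add_smul]
    module
  have hez : A' • (y' - x) = a • (z' - z) := by
    rw [he, eq_neg_of_add_eq_zero_left hpr]
    module
  have hcen : (α * (κ - 1 + A')) • (((κ - 1 + A) / (κ - 1 + A')) • z
      + (a / (κ - 1 + A')) • (x - (1 / α) • G) - z')
      = (α * (κ - 1 + A)) • (z - z') + (a * α) • (x - z') - a • G := by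
    rw [hA'] at hB ⊢
    match_scalars <;> (field_simp; try ring)
  -- the projection inequality, with the denominator `κ - 1 + A'` cleared
  have h4 : α * (κ - 1 + A) * ⟪z - z', u - z'⟫ + a * α * ⟪x - z', u - z'⟫
      - a * ⟪G, u - z'⟫ ≤ 0 := by
    have := mul_nonpos_of_nonneg_of_nonpos (mul_pos hα hB).le hproj
    rw [← real_inner_smul_left, hcen] at this
    simpa only [inner_sub_left, inner_add_left, real_inner_smul_left] using this
  have i1 : ⟪z - z', u - z'⟫ = (‖z' - z‖ ^ 2 + ‖z' - u‖ ^ 2 - ‖z - u‖ ^ 2) / 2 := by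
    have : z - u = (z - z') - (u - z') := by abel
    rw [this, norm_sub_sq_real (z - z'), norm_sub_rev z' z, norm_sub_rev z' u]; ring
  have i2 : ⟪x - z', u - z'⟫ = (‖z' - x‖ ^ 2 + ‖z' - u‖ ^ 2 - ‖u - x‖ ^ 2) / 2 := by
    have : u - x = (u - z') - (x - z') := by abel
    rw [this, norm_sub_sq_real (u - z'), norm_sub_rev z' x, norm_sub_rev z' u, real_inner_comm]; ring
  have i3 : ⟪G, u - z'⟫ = ⟪G, u - x⟫ - ⟪G, z' - x⟫ := by
    rw [← inner_sub_right]; congr 1; abel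
  have i4 : A' * ⟪G, y' - x⟫ = A * ⟪G, y - x⟫ + a * ⟪G, z' - x⟫ := by
    rw [← real_inner_smul_right, he, inner_add_right, real_inner_smul_right,
      real_inner_smul_right]
  have i5 : A' ^ 2 * ‖y' - x‖ ^ 2 = a ^ 2 * ‖z' - z‖ ^ 2 := by
    have := congrArg (fun v => ‖v‖ ^ 2) hez
    simpa only [norm_smul, mul_pow, Real.norm_eq_abs, sq_abs] using this
  -- Jensen for the squared norm at `y' - x`, a convex combination of `y - x` and `z' - x`
  have i6 : A' * ‖y' - x‖ ^ 2 ≤ A * ‖y - x‖ ^ 2 + a * ‖z' - x‖ ^ 2 := by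
    have h1 : A' * (A' * ‖y' - x‖ ^ 2)
        = A' * (A * ‖y - x‖ ^ 2 + a * ‖z' - x‖ ^ 2)
          - A * a * ‖(y - x) - (z' - x)‖ ^ 2 := by
      have := congrArg (fun v => ‖v‖ ^ 2) he
      simp only [norm_add_sq_real, norm_smul, mul_pow, Real.norm_eq_abs, sq_abs,
        real_inner_smul_left, real_inner_smul_right] at this
      rw [norm_sub_sq_real (y - x), ← mul_assoc, ← sq, this, hA']
      ring
    refine le_of_mul_le_mul_left ?_ hA'0
    rw [h1]
    have : 0 ≤ A * a * ‖(y - x) - (z' - x)‖ ^ 2 := by positivity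
    linarith
  have i7 : (κ - 1) * (A' * ‖y' - x‖ ^ 2) ≤ (κ - 1 + A) * ‖z' - z‖ ^ 2 := by
    refine le_of_mul_le_mul_left ?_ hA'0
    calc A' * ((κ - 1) * (A' * ‖y' - x‖ ^ 2)) = (κ - 1) * (A' ^ 2 * ‖y' - x‖ ^ 2) := by ring
      _ = (κ - 1) * a ^ 2 * ‖z' - z‖ ^ 2 := by rw [i5]; ring
      _ ≤ (κ - 1 + A) * A' * ‖z' - z‖ ^ 2 := by gcongr
      _ = _ := by ring
  rw [i1, i2, i3] at h4
  have j1 := mul_le_mul_of_nonneg_left hfy' hA'0.le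
  have j2 := mul_le_mul_of_nonneg_left hfy hA
  have j3 := mul_le_mul_of_nonneg_left hfu ha.le
  have j6 := mul_le_mul_of_nonneg_left i6 (half_pos hα).le
  have j7 := mul_le_mul_of_nonneg_left i7 (half_pos hα).le
  have i4' : A' * (fx + ⟪G, y' - x⟫ + κ * α / 2 * ‖y' - x‖ ^ 2)
    = A' * fx + (A * ⟪G, y - x⟫ + a * ⟪G, z' - x⟫) + A' * (κ * α / 2 * ‖y' - x‖ ^ 2) := by
    rw [← i4]; ring
  rw [i4'] at j1
  clear i1 i2 i3 i4 i4' i5 i6 i7 hez he hcen hpr hproj hx hy' hfy hfu hfy' hcoef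
  subst hA'
  linarith

end Accelerated

/-! ### Growth of the weights -/

/-- The factor by which `A_k` grows in one iteration of accelerated projected gradient descent
with condition number `κ`. -/
noncomputable def growth (κ : ℝ) : ℝ := 2 * κ / (2 * κ + 1 - √(1 + 4 * κ))

theorem growth_denom_pos {κ : ℝ} (hκ : 1 ≤ κ) : 0 < 2 * κ + 1 - √(1 + 4 * κ) := by
  have : √(1 + 4 * κ) < 2 * κ + 1 := by
    rw [Real.sqrt_lt' (by linarith)]
    nlinarith
  linarith

theorem exp_le_growth {κ : ℝ} (hκ : 1 ≤ κ) : Real.exp (1 / (2 * √κ)) ≤ growth κ := by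
  have hD := growth_denom_pos hκ
  have hr : 1 ≤ √κ := Real.one_le_sqrt.2 hκ
  have hr2 : √κ ^ 2 = κ := Real.sq_sqrt (by linarith)
  have hs : 1 + √κ ≤ √(1 + 4 * κ) := Real.le_sqrt_of_sq_le (by nlinarith)
  have h1 : 1 / (2 * √κ) ≤ (√(1 + 4 * κ) - 1) / (2 * κ) := by
    rw [div_le_div_iff₀ (by positivity) (by positivity)]
    nlinarith
  have h2 : (growth κ)⁻¹ ≤ Real.exp (-(1 / (2 * √κ))) := by
    calc (growth κ)⁻¹ = -((√(1 + 4 * κ) - 1) / (2 * κ)) + 1 := by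
          rw [growth, inv_div]; field_simp; ring
      _ ≤ -(1 / (2 * √κ)) + 1 := by linarith
      _ ≤ _ := Real.add_one_le_exp _
  rw [Real.exp_neg] at h2
  exact (inv_le_inv₀ (by unfold growth; positivity) (Real.exp_pos _)).1 h2

theorem one_lt_growth {κ : ℝ} (hκ : 1 ≤ κ) : 1 < growth κ := by
  refine lt_of_lt_of_le (Real.one_lt_exp_iff.2 ?_) (exp_le_growth hκ)
  have : 0 < √κ := Real.sqrt_pos.2 (by linarith)
  positivity

/-- `growth κ` is chosen so that `a = A * (growth κ - 1)` satisfies the step size requirement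
`(κ - 1) * a ^ 2 ≤ (κ - 1 + A) * (A + a)`. -/
theorem growth_sub_one_sq {κ : ℝ} (hκ : 1 ≤ κ) : κ * (growth κ - 1) ^ 2 = growth κ := by
  have hD := growth_denom_pos hκ
  have hs : √(1 + 4 * κ) ^ 2 = 1 + 4 * κ := Real.sq_sqrt (by linarith)
  unfold growth
  set s := √(1 + 4 * κ)
  have : 2 * κ / (2 * κ + 1 - s) - 1 = (s - 1) / (2 * κ + 1 - s) := by
    field_simp; ring
  rw [this]
  have : (s - 1) ^ 2 = 2 * (2 * κ + 1 - s) := by linarith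
  rw [div_pow, this]
  field_simp

/-! ### Convergence of accelerated projected gradient descent -/

/-- The projection onto a nonempty closed convex set satisfies the variational inequality which
characterizes it. -/
theorem proj_spec {n : ℕ} {C : Set (E n)} (hne : C.Nonempty) (hcl : IsClosed C)
    (hcv : Convex ℝ C) (x : E n) :
    proj C x ∈ C ∧ ∀ u ∈ C, ⟪x - proj C x, u - proj C x⟫ ≤ 0 := by
  obtain ⟨v, hv, hmin⟩ := exists_norm_eq_iInf_of_complete_convex hne hcl.isComplete hcv x
  have hbdd : BddBelow (Set.range fun w : C => ‖x - w‖) :=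
    ⟨0, by rintro _ ⟨w, rfl⟩; exact norm_nonneg _⟩
  have hp : IsArgminOn (fun y => ‖x - y‖) C (proj C x) :=
    Classical.epsilon_spec (p := IsArgminOn (fun y => ‖x - y‖) C)
      ⟨v, hv, fun y hy => hmin.trans_le (ciInf_le hbdd ⟨y, hy⟩)⟩
  refine ⟨hp.1, (norm_eq_iInf_iff_real_inner_le_zero hcv hp.1).1 ?_⟩
  have : Nonempty C := ⟨⟨v, hv⟩⟩
  exact le_antisymm (le_ciInf fun w => hp.2 w w.2) (ciInf_le hbdd ⟨_, hp.1⟩)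

section Apgd

variable {n : ℕ} {C : Set (E n)} {f : E n → ℝ} {α L : ℝ}

/-- The invariant of accelerated projected gradient descent after `N` iterations: the potential
`A (f y - f u) + α (κ - 1 + A) / 2 * ‖z - u‖²` is at most its initial value, and `A` is a power of
`growth κ`. -/
theorem apgd_invariant (hα : 0 < α) (hL : α ≤ L) (hcl : IsClosed C) (hcv : Convex ℝ C)
    (hlow : ∀ x y, f x + ⟪gradient f x, y - x⟫ + α / 2 * ‖y - x‖ ^ 2 ≤ f y)
    (hup : ∀ x y, f y ≤ f x + ⟪gradient f x, y - x⟫ + L / 2 * ‖y - x‖ ^ 2)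
    {x₀ u : E n} (hx₀ : x₀ ∈ C) (hu : u ∈ C) (N : ℕ) :
    let s := (apgdStep C f α L)^[N] { y := x₀, z := x₀, A := 0, a := 1 }
    s.y ∈ C ∧ s.z ∈ C ∧
    (s.A = 0 ∧ s.a = 1 ∧ N = 0 ∨
      ∃ k, N = k + 1 ∧ s.A = growth (L / α) ^ k ∧ s.a = s.A * (growth (L / α) - 1)) ∧
    s.A * (f s.y - f u) + α * (L / α - 1 + s.A) / 2 * ‖s.z - u‖ ^ 2
      ≤ (L - α) / 2 * ‖x₀ - u‖ ^ 2 := by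
  have hκ : 1 ≤ L / α := (one_le_div hα).2 hL
  have hq := one_lt_growth hκ
  have hq2 := growth_sub_one_sq hκ
  induction N with
  | zero =>
    refine ⟨hx₀, hx₀, Or.inl ⟨rfl, rfl, rfl⟩, le_of_eq ?_⟩
    simp only [Function.iterate_zero, id]
    field_simp
    ring
  | succ N ih =>
    rw [Function.iterate_succ_apply']
    set s := (apgdStep C f α L)^[N] { y := x₀, z := x₀, A := 0, a := 1 } with hs
    obtain ⟨hy, hz, hA, hpot⟩ := ih
    have hA0 : 0 ≤ s.A := by
      rcases hA with h | ⟨k, -, h, -⟩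
      · exact h.1.ge
      · rw [h]; positivity
    have ha0 : 0 < s.a := by
      rcases hA with h | ⟨k, -, h, h'⟩
      · rw [h.2.1]; exact one_pos
      · rw [h', h]; exact mul_pos (by positivity) (by linarith)
    have hcoef : (L / α - 1) * s.a ^ 2 ≤ (L / α - 1 + s.A) * (s.A + s.a) := by
      rcases hA with ⟨h, h', -⟩ | ⟨k, -, -, h⟩
      · rw [h, h']; simp
      · have h1 : (L / α - 1) * (growth (L / α) - 1) ^ 2 ≤ growth (L / α) := by
          nlinarith [sq_nonneg (growth (L / α) - 1)]
        have h2 : 0 ≤ (L / α - 1) * (s.A * growth (L / α)) :=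
          mul_nonneg (by linarith) (mul_nonneg hA0 (by linarith))
        rw [h]
        nlinarith [mul_le_mul_of_nonneg_left h1 (sq_nonneg s.A)]
    set A' := s.A + s.a with hA'
    have hA'0 : 0 < A' := by linarith
    set x := (s.A / A') • s.y + (s.a / A') • s.z with hx
    set w := ((L / α - 1 + s.A) / (L / α - 1 + A')) • s.z
      + (s.a / (L / α - 1 + A')) • (x - (1 / α) • gradient f x) with hw
    obtain ⟨hp, hp'⟩ := proj_spec ⟨x₀, hx₀⟩ hcl hcv w
    have hstep : apgdStep C f α L s = ⟨(s.A / A') • s.y + (s.a / A') • proj C w, proj C w, A',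
      A' * (growth (L / α) - 1)⟩ := rfl
    rw [hstep]
    refine ⟨hcv hy hp (by positivity) (by positivity) ?_, hp, Or.inr ⟨N, rfl, ?_, rfl⟩, ?_⟩
    · rw [← add_div, div_self hA'0.ne']
    · rcases hA with ⟨h, h', h''⟩ | ⟨k, h'', h, h'⟩
      · simp [hA', h, h', h'']
      · simp only [hA']
        rw [h', h, h'']; ring
    · refine le_trans (potential_step hα hκ hA0 ha0 hA' hcoef hx rfl (hlow x s.y) (hlow x u) ?_
        (hp' u hu)) hpot
      rw [div_mul_cancel₀ _ hα.ne']
      exact hup _ _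

/-- Linear convergence of accelerated projected gradient descent, for a positive number of
iterations. -/
theorem apgd_accuracy (hα : 0 < α) (hL : α ≤ L) (hcl : IsClosed C) (hcv : Convex ℝ C)
    (hlow : ∀ x y, f x + ⟪gradient f x, y - x⟫ + α / 2 * ‖y - x‖ ^ 2 ≤ f y)
    (hup : ∀ x y, f y ≤ f x + ⟪gradient f x, y - x⟫ + L / 2 * ‖y - x‖ ^ 2)
    {x₀ u : E n} (hx₀ : x₀ ∈ C) (hu : u ∈ C) (N : ℕ) :
    apgd C x₀ f α L (N + 1) ∈ C ∧
    Real.exp (N / (2 * √(L / α))) * (f (apgd C x₀ f α L (N + 1)) - f u)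
      ≤ (L - α) / 2 * ‖x₀ - u‖ ^ 2 := by
  have hκ : 1 ≤ L / α := (one_le_div hα).2 hL
  obtain ⟨hy, -, hA, hpot⟩ := apgd_invariant hα hL hcl hcv hlow hup hx₀ hu (N + 1)
  rw [← apgd] at hy hpot
  refine ⟨hy, ?_⟩
  rcases le_or_gt (f (apgd C x₀ f α L (N + 1)) - f u) 0 with h0 | h0
  · exact (mul_nonpos_of_nonneg_of_nonpos (Real.exp_pos _).le h0).trans
      (mul_nonneg (by linarith) (sq_nonneg _))
  obtain ⟨-, -, h⟩ | ⟨k, hk, hA, -⟩ := hA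
  · omega
  obtain rfl : N = k := by omega
  rw [hA] at hpot
  have h1 : Real.exp (N / (2 * √(L / α))) ≤ growth (L / α) ^ N := by
    calc Real.exp (N / (2 * √(L / α))) = Real.exp (1 / (2 * √(L / α))) ^ N := by
          rw [← Real.exp_nat_mul]; congr 1; ring
      _ ≤ _ := pow_le_pow_left₀ (Real.exp_pos _).le (exp_le_growth hκ) N
  have h2 : 0 ≤ growth (L / α) ^ N := (Real.exp_pos _).le.trans h1
  refine le_trans (mul_le_mul_of_nonneg_right h1 h0.le) (le_trans ?_ hpot)
  have : 0 ≤ α * (L / α - 1 + growth (L / α) ^ N) / 2 := by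
    have : 0 ≤ L / α - 1 := by linarith
    positivity
  exact le_add_of_nonneg_right (mul_nonneg this (sq_nonneg _))

end Apgd

/-! ### The quadratic objective -/

/-- What the argument uses about the objective `g`: it is `α`-strongly convex and `L`-smooth, and
its gradient is affine with linear part `Q`, whose off-diagonal entries are nonpositive. -/
structure IsMQuadratic {n : ℕ} (Q : Matrix (Fin n) (Fin n) ℝ) (α L : ℝ) (g : E n → ℝ) : Prop where
  offdiag : ∀ i j, i ≠ j → Q i j ≤ 0
  pos : 0 < α
  le : α ≤ L
  continuous : Continuous g
  low : ∀ x y, g x + ⟪gradient g x, y - x⟫ + α / 2 * ‖y - x‖ ^ 2 ≤ g y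
  up : ∀ x y, g y ≤ g x + ⟪gradient g x, y - x⟫ + L / 2 * ‖y - x‖ ^ 2
  grad_sub : ∀ x y i, gradient g y i - gradient g x i = ∑ j, Q i j * (y j - x j)
  lipschitz : ∀ x y, ‖gradient g y - gradient g x‖ ≤ L * ‖y - x‖

section Quad

variable {n : ℕ} {Q : Matrix (Fin n) (Fin n) ℝ}

open Matrix in
theorem inner_toEuclideanCLM_comm (hQ : Q.IsHermitian) (x y : E n) :
    ⟪x, toEuclideanCLM (𝕜 := ℝ) Q y⟫ = ⟪y, toEuclideanCLM (𝕜 := ℝ) Q x⟫ := by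
  have hT : Qᵀ = Q := hQ
  rw [inner_toEuclideanCLM, inner_toEuclideanCLM, dotProduct_mulVec, ← mulVec_transpose, hT,
    dotProduct_comm]

open Matrix in
theorem quad_eq_add (hQ : Q.IsHermitian) (b : E n) (c : ℝ) (x y : E n) :
    quad Q b c y = quad Q b c x + ⟪toEuclideanCLM (𝕜 := ℝ) Q x - b, y - x⟫
      + 1 / 2 * ⟪y - x, toEuclideanCLM (𝕜 := ℝ) Q (y - x)⟫ := by
  have hq : ∀ z, quad Q b c z = 1 / 2 * ⟪z, toEuclideanCLM (𝕜 := ℝ) Q z⟫ - ⟪b, z⟫ + c := by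
    intro z
    rw [inner_toEuclideanCLM, real_inner_comm z b, EuclideanSpace.inner_eq_star_dotProduct]
    rfl
  rw [hq, hq]
  simp only [map_sub, inner_sub_left, inner_sub_right,
    real_inner_comm y (toEuclideanCLM (𝕜 := ℝ) Q x),
    real_inner_comm x (toEuclideanCLM (𝕜 := ℝ) Q x), inner_toEuclideanCLM_comm hQ y x]
  ring

open Matrix in
theorem gradient_quad (hQ : Q.IsHermitian) (b : E n) (c : ℝ) (x : E n) :
    gradient (quad Q b c) x = toEuclideanCLM (𝕜 := ℝ) Q x - b := by
  refine HasGradientAt.gradient ?_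
  rw [hasGradientAt_iff_isLittleO]
  have : (fun y => quad Q b c y - quad Q b c x - ⟪toEuclideanCLM (𝕜 := ℝ) Q x - b, y - x⟫)
      = fun y => 1 / 2 * ⟪y - x, toEuclideanCLM (𝕜 := ℝ) Q (y - x)⟫ := by
    funext y
    rw [quad_eq_add hQ b c x y]; ring
  rw [this]
  refine Asymptotics.IsBigO.trans_isLittleO (g := fun y => ‖y - x‖ ^ 2) ?_ ?_
  · refine Asymptotics.IsBigO.of_bound (1 / 2 * ‖toEuclideanCLM (𝕜 := ℝ) Q‖) (.of_forall fun y => ?_)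
    rw [norm_mul, Real.norm_of_nonneg (by norm_num : (0 : ℝ) ≤ 1 / 2),
      Real.norm_of_nonneg (sq_nonneg ‖y - x‖), mul_assoc]
    refine mul_le_mul_of_nonneg_left ?_ (by norm_num)
    refine (norm_inner_le_norm _ _).trans ?_
    have := (toEuclideanCLM (𝕜 := ℝ) Q).le_opNorm (y - x)
    nlinarith [norm_nonneg (y - x)]
  · refine Asymptotics.IsLittleO.of_norm_right (Asymptotics.isLittleO_iff.2 fun c hc => ?_)
    filter_upwards [Metric.ball_mem_nhds x hc] with y hy
    rw [mem_ball_iff_norm] at hy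
    rw [norm_pow, norm_norm, sq]
    exact mul_le_mul_of_nonneg_right hy.le (norm_nonneg _)

open Matrix in
/-- The dimension has to be positive for the two matrix inequalities to give `α ≤ L`. -/
theorem isMQuadratic_quad [NeZero n] {α L : ℝ} (hQ : Q.PosDef) (hM : ∀ i j, i ≠ j → Q i j ≤ 0)
    (hα : 0 < α) (hαQ : (Q - α • (1 : Matrix (Fin n) (Fin n) ℝ)).PosSemidef)
    (hLQ : (L • (1 : Matrix (Fin n) (Fin n) ℝ) - Q).PosSemidef) (b : E n) (c : ℝ) :
    IsMQuadratic Q α L (quad Q b c) := by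
  set T := toEuclideanCLM (𝕜 := ℝ) Q with hT
  have hH := hQ.isHermitian
  have hnorm : ∀ d : E n, d.ofLp ⬝ᵥ d.ofLp = ‖d‖ ^ 2 := fun d => by
    rw [← real_inner_self_eq_norm_sq, EuclideanSpace.inner_eq_star_dotProduct]; rfl
  have h1 : ∀ d : E n, α * ‖d‖ ^ 2 ≤ ⟪d, T d⟫ := fun d => by
    have := hαQ.dotProduct_mulVec_nonneg d.ofLp
    rw [sub_mulVec, smul_mulVec, one_mulVec, dotProduct_sub, dotProduct_smul, star_trivial,
      hnorm, smul_eq_mul] at this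
    rw [inner_toEuclideanCLM]
    linarith
  have h2 : ∀ d : E n, ⟪d, T d⟫ ≤ L * ‖d‖ ^ 2 := fun d => by
    have := hLQ.dotProduct_mulVec_nonneg d.ofLp
    rw [sub_mulVec, smul_mulVec, one_mulVec, dotProduct_sub, dotProduct_smul, star_trivial,
      hnorm, smul_eq_mul] at this
    rw [inner_toEuclideanCLM]
    linarith
  have hle : α ≤ L := by
    have h := (h1 (EuclideanSpace.single 0 1)).trans (h2 _)
    simpa using h
  have hL : 0 < L := hα.trans_le hle
  have hgs : ∀ x y, gradient (quad Q b c) y - gradient (quad Q b c) x = T (y - x) := fun x y => by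
    rw [gradient_quad hH, gradient_quad hH, map_sub]; abel
  refine ⟨hM, hα, hle, ?_, fun x y => ?_, fun x y => ?_, fun x y i => ?_, fun x y => ?_⟩
  · have : quad Q b c = fun y => quad Q b c 0 + ⟪T 0 - b, y - 0⟫ + 1 / 2 * ⟪y - 0, T (y - 0)⟫ :=
      funext fun y => quad_eq_add hH b c 0 y
    rw [this]
    fun_prop
  · rw [quad_eq_add hH b c x y, gradient_quad hH]
    linarith [h1 (y - x)]
  · rw [quad_eq_add hH b c x y, gradient_quad hH]
    linarith [h2 (y - x)]
  · have := congrArg (fun v : E n => v i) (hgs x y)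
    simpa [T, mulVec, dotProduct, mul_sub] using this
  · rw [hgs]
    set d := y - x
    -- expand the quadratic form of `Q` at `d - L⁻¹ • Q d`
    have h3 : ‖T d‖ ^ 2 ≤ L * ⟪d, T d⟫ := by
      have h4 : 0 ≤ ⟪L • d - T d, T (L • d - T d)⟫ :=
        le_trans (mul_nonneg hα.le (sq_nonneg _)) (h1 _)
      simp only [map_sub, map_smul, inner_sub_left, inner_sub_right, real_inner_smul_left,
        real_inner_smul_right, real_inner_self_eq_norm_sq, hT,
        inner_toEuclideanCLM_comm hH d (toEuclideanCLM (𝕜 := ℝ) Q d)] at h4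
      have h5 := h2 (T d)
      refine le_of_mul_le_mul_left ?_ hL
      linarith
    refine abs_le_of_sq_le_sq' ?_ (by positivity) |>.2
    calc ‖T d‖ ^ 2 ≤ L * ⟪d, T d⟫ := h3
      _ ≤ L * (L * ‖d‖ ^ 2) := mul_le_mul_of_nonneg_left (h2 d) hL.le
      _ = _ := by ring

end Quad

/-! ### The cones `face S` -/

section Face

variable {n : ℕ} {S : Finset (Fin n)}

theorem mem_face {x : E n} : x ∈ face S ↔ (∀ i, 0 ≤ x i) ∧ ∀ i ∉ S, x i = 0 := by
  rw [face, Set.mem_inter_iff, and_comm]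
  refine and_congr Iff.rfl ⟨fun hx i hi => ?_, fun hx => ?_⟩
  · refine Submodule.span_induction (p := fun v _ => v i = 0) ?_ rfl ?_ ?_ hx
    · rintro _ ⟨j, hj, rfl⟩
      have : i ≠ j := fun h => hi (h ▸ hj)
      simp [this]
    · intro u v _ _ hu hv
      simp [hu, hv]
    · intro a v _ hv
      simp [hv]
  · have : x = ∑ i ∈ S, x i • EuclideanSpace.single i (1 : ℝ) := by
      ext j
      by_cases hj : j ∈ S
      · simp [Pi.single_apply, hj]
      · simp [Pi.single_apply, hj, hx j hj]
    rw [this]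
    exact Submodule.sum_mem _ fun i hi => Submodule.smul_mem _ _ (Submodule.subset_span ⟨i, hi, rfl⟩)

theorem face_univ : face (Finset.univ : Finset (Fin n)) = orthant n := by
  ext x
  simp [mem_face, orthant]

theorem zero_mem_face : (0 : E n) ∈ face S := mem_face.2 ⟨fun _ => le_rfl, fun _ _ => rfl⟩

theorem face_mono {S' : Finset (Fin n)} (h : S ⊆ S') : face S ⊆ face S' := fun _ hx =>
  mem_face.2 ⟨(mem_face.1 hx).1, fun i hi => (mem_face.1 hx).2 i fun h' => hi (h h')⟩

theorem isClosed_face : IsClosed (face S) := by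
  have : face S = (⋂ i, {x : E n | 0 ≤ x i}) ∩ ⋂ i, ⋂ (_ : i ∉ S), {x : E n | x i = 0} := by
    ext x; simp [mem_face]
  rw [this]
  refine (isClosed_iInter fun i => isClosed_le continuous_const (by fun_prop)).inter
    (isClosed_iInter fun i => isClosed_iInter fun _ => isClosed_eq (by fun_prop) continuous_const)

theorem convex_face : Convex ℝ (face S) := by
  intro x hx y hy a b ha hb _
  rw [mem_face] at *
  refine ⟨fun i => ?_, fun i hi => ?_⟩
  · exact add_nonneg (mul_nonneg ha (hx.1 i)) (mul_nonneg hb (hy.1 i))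
  · simp [hx.2 i hi, hy.2 i hi]

end Face

/-! ### Minimizers of the objective over closed convex sets -/

theorem inner_eq_sum {n : ℕ} (x y : E n) : ⟪x, y⟫ = ∑ i, x i * y i := by
  simp [PiLp.inner_apply, mul_comm]

namespace IsMQuadratic

variable {n : ℕ} {Q : Matrix (Fin n) (Fin n) ℝ} {α L : ℝ} {g : E n → ℝ}

theorem grad_strongly_mono (h : IsMQuadratic Q α L g) (x y : E n) :
    α * ‖y - x‖ ^ 2 ≤ ⟪gradient g y - gradient g x, y - x⟫ := by
  have h1 := h.low x y
  have h2 := h.low y x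
  rw [norm_sub_rev x y, ← neg_sub y x, inner_neg_right] at h2
  rw [inner_sub_left]
  linarith

/-- Strong convexity confines the minimization to a closed ball around any point of `C`, of radius
`2 / α` times the norm of the gradient there. -/
theorem exists_argmin (h : IsMQuadratic Q α L g) {C : Set (E n)} (hne : C.Nonempty)
    (hcl : IsClosed C) : ∃ w, IsArgminOn g C w := by
  obtain ⟨x₀, hx₀⟩ := hne
  have hα := h.pos
  set R := 2 * ‖gradient g x₀‖ / α with hR
  have hR0 : 0 ≤ R := by positivity
  obtain ⟨w, hw, hmin⟩ := ((isCompact_closedBall x₀ R).inter_right hcl).exists_isMinOn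
    ⟨x₀, Metric.mem_closedBall_self hR0, hx₀⟩ h.continuous.continuousOn
  refine ⟨w, hw.2, fun y hy => ?_⟩
  by_cases hyR : y ∈ Metric.closedBall x₀ R
  · exact hmin ⟨hyR, hy⟩
  · refine le_trans (hmin ⟨Metric.mem_closedBall_self hR0, hx₀⟩) ?_
    rw [mem_closedBall_iff_norm, not_le, hR, div_lt_iff₀ hα] at hyR
    have h1 := h.low x₀ y
    have h2 := abs_le.1 (abs_real_inner_le_norm (gradient g x₀) (y - x₀))
    have h3 := norm_nonneg (y - x₀)
    nlinarith

theorem inner_grad_nonneg (h : IsMQuadratic Q α L g) {C : Set (E n)} (hcv : Convex ℝ C) {w u : E n}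
    (hw : IsArgminOn g C w) (hu : u ∈ C) : 0 ≤ ⟪gradient g w, u - w⟫ := by
  by_contra! hp
  set p := ⟪gradient g w, u - w⟫
  set K := L / 2 * ‖u - w‖ ^ 2 with hK
  have hL := h.pos.trans_le h.le
  have hK0 : 0 ≤ K := by positivity
  -- a step of this length towards `u` makes the first-order decrease outweigh the second-order term
  set s := min 1 (-p / (K + 1)) with hs
  have hs0 : 0 < s := lt_min one_pos (div_pos (by linarith) (by linarith))
  have hmem : w + s • (u - w) ∈ C :=
    hcv.add_smul_sub_mem hw.1 hu ⟨hs0.le, min_le_left _ _⟩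
  have h1 := hw.2 _ hmem
  have h2 := h.up w (w + s • (u - w))
  rw [add_sub_cancel_left, real_inner_smul_right, norm_smul, mul_pow, Real.norm_eq_abs,
    sq_abs] at h2
  have h3 : s * (K + 1) ≤ -p := by
    rw [← le_div_iff₀ (by linarith)]; exact min_le_right _ _
  have h4 : 0 ≤ s * (p + s * K) := by
    have : s * (p + s * K) = s * p + L / 2 * (s ^ 2 * ‖u - w‖ ^ 2) := by rw [hK]; ring
    rw [this]
    linarith
  have h5 := nonneg_of_mul_nonneg_right h4 hs0
  linarith

theorem argmin_gap (h : IsMQuadratic Q α L g) {C : Set (E n)} (hcv : Convex ℝ C) {w u : E n}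
    (hw : IsArgminOn g C w) (hu : u ∈ C) : α / 2 * ‖u - w‖ ^ 2 ≤ g u - g w := by
  linarith [h.low w u, h.inner_grad_nonneg hcv hw hu]

theorem isArgminOn_iff (h : IsMQuadratic Q α L g) {C : Set (E n)} (hcv : Convex ℝ C) {w : E n}
    (hw : IsArgminOn g C w) (y : E n) : IsArgminOn g C y ↔ y = w := by
  refine ⟨fun hy => ?_, fun hy => hy ▸ hw⟩
  have h1 := h.argmin_gap hcv hw hy.1
  have h2 := hy.2 w hw.1
  have h3 : ‖y - w‖ ^ 2 ≤ 0 := by nlinarith [h.pos]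
  rw [← sub_eq_zero, ← norm_eq_zero]
  exact pow_eq_zero_iff two_ne_zero |>.1 (le_antisymm h3 (sq_nonneg _))

theorem isArgminOn_argminOn (h : IsMQuadratic Q α L g) (S : Finset (Fin n)) :
    IsArgminOn g (face S) (argminOn g (face S)) :=
  Classical.epsilon_spec (h.exists_argmin ⟨0, zero_mem_face⟩ isClosed_face)

theorem grad_nonneg (h : IsMQuadratic Q α L g) {S : Finset (Fin n)} {w : E n}
    (hw : IsArgminOn g (face S) w) {i : Fin n} (hi : i ∈ S) : 0 ≤ gradient g w i := by
  have hw' := mem_face.1 hw.1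
  have : w + EuclideanSpace.single i (1 : ℝ) ∈ face S := by
    refine mem_face.2 ⟨fun j => add_nonneg (hw'.1 j) ?_, fun j hj => ?_⟩
    · by_cases hj : j = i <;> simp [hj]
    · have : j ≠ i := fun e => hj (e ▸ hi)
      simp [hw'.2 j hj, this]
  have h1 := h.inner_grad_nonneg convex_face hw this
  rwa [add_sub_cancel_left, EuclideanSpace.inner_single_right, one_mul] at h1

theorem grad_eq_zero (h : IsMQuadratic Q α L g) {S : Finset (Fin n)} {w : E n}
    (hw : IsArgminOn g (face S) w) {i : Fin n} (hi : 0 < w i) : gradient g w i = 0 := by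
  have hw' := mem_face.1 hw.1
  have hiS : i ∈ S := by
    by_contra hiS
    exact hi.ne' (hw'.2 i hiS)
  refine le_antisymm ?_ (h.grad_nonneg hw hiS)
  have : w - EuclideanSpace.single i (w i) ∈ face S := by
    refine mem_face.2 ⟨fun j => ?_, fun j hj => ?_⟩
    · by_cases hj : j = i
      · subst hj; simp
      · simpa [hj] using hw'.1 j
    · have : j ≠ i := fun e => hj (e ▸ hiS)
      simp [hw'.2 j hj, this]
  have h1 := h.inner_grad_nonneg convex_face hw this
  rw [sub_sub_cancel_left, inner_neg_right, EuclideanSpace.inner_single_right] at h1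
  have h2 : 0 ≤ -(w i * gradient g w i) := h1
  nlinarith

/-! ### Comparison principle -/

/-- The gradient at `i` can only decrease when the other coordinates increase. -/
theorem grad_anti (h : IsMQuadratic Q α L g) {v w : E n} (hvw : ∀ j, v j ≤ w j) {i : Fin n}
    (hi : v i = w i) : gradient g w i ≤ gradient g v i := by
  rw [← sub_nonpos, h.grad_sub]
  refine Finset.sum_nonpos fun j _ => ?_
  by_cases hj : i = j
  · subst hj; simp [hi]
  · exact mul_nonpos_of_nonpos_of_nonneg (h.offdiag i j hj) (sub_nonneg.2 (hvw j))

/-- Comparison principle: testing the gradient difference with the positive part of `v - w`. -/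
theorem le_of_grad (h : IsMQuadratic Q α L g) {v w : E n} (hw0 : ∀ i, 0 ≤ w i)
    (hv : ∀ i, 0 < v i → gradient g v i ≤ 0) (hw : ∀ i, 0 < v i → 0 ≤ gradient g w i) (i : Fin n) :
    v i ≤ w i := by
  set p : E n := WithLp.toLp 2 fun i => max (v i - w i) 0 with hp
  have hpi : ∀ i, p i = max (v i - w i) 0 := fun i => rfl
  have h1 := h.grad_strongly_mono w (w + p)
  rw [add_sub_cancel_left] at h1
  have h2 : ⟪gradient g (w + p) - gradient g w, p⟫ ≤ ⟪gradient g v - gradient g w, p⟫ := by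
    rw [inner_eq_sum, inner_eq_sum]
    refine Finset.sum_le_sum fun i _ => ?_
    rw [PiLp.sub_apply, PiLp.sub_apply, h.grad_sub, h.grad_sub, Finset.sum_mul, Finset.sum_mul]
    refine Finset.sum_le_sum fun j _ => ?_
    have hpi0 : 0 ≤ p i := le_max_right _ _
    rw [PiLp.add_apply, add_sub_cancel_left]
    by_cases hj : i = j
    · subst hj
      rw [hpi]
      rcases le_total (v i - w i) 0 with h | h <;> simp [h]
    · exact mul_le_mul_of_nonneg_right
        (mul_le_mul_of_nonpos_left (le_max_left _ _) (h.offdiag i j hj)) hpi0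
  have h3 : ⟪gradient g v - gradient g w, p⟫ ≤ 0 := by
    rw [inner_eq_sum]
    refine Finset.sum_nonpos fun i _ => ?_
    rw [PiLp.sub_apply, hpi]
    rcases le_or_gt (v i - w i) 0 with h0 | h0
    · simp [h0]
    · have hvi : 0 < v i := by linarith [hw0 i]
      refine mul_nonpos_of_nonpos_of_nonneg ?_ (le_max_right _ _)
      linarith [hv i hvi, hw i hvi]
  have h4 : ‖p‖ ^ 2 ≤ 0 := by nlinarith [h.pos]
  have h5 : p = 0 := by
    rw [← norm_eq_zero]
    exact pow_eq_zero_iff two_ne_zero |>.1 (le_antisymm h4 (sq_nonneg _))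
  have h6 : max (v i - w i) 0 = 0 := by rw [← hpi, h5]; rfl
  linarith [le_max_left (v i - w i) 0]

/-- A subsolution `v` on the face of `S` which is strict where it vanishes lies below the minimizer
over that face, and this minimizer is in the relative interior of the face. -/
theorem argmin_face_of_subsolution (h : IsMQuadratic Q α L g) {S : Finset (Fin n)} {v w : E n}
    (hv : v ∈ face S)
    (hS : ∀ i ∈ S, 0 < v i ∧ gradient g v i ≤ 0 ∨ gradient g v i < 0)
    (hw : IsArgminOn g (face S) w) :
    (∀ i, v i ≤ w i) ∧ ∀ i ∈ S, 0 < w i ∧ gradient g w i = 0 := by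
  have hv' := mem_face.1 hv
  have hw' := mem_face.1 hw.1
  have hvS : ∀ i, 0 < v i → i ∈ S := fun i hi => by
    by_contra hiS
    exact hi.ne' (hv'.2 i hiS)
  have hle : ∀ i, v i ≤ w i := h.le_of_grad hw'.1
    (fun i hi => (hS i (hvS i hi)).elim (fun h => h.2) le_of_lt)
    (fun i hi => h.grad_nonneg hw (hvS i hi))
  refine ⟨hle, fun i hi => ?_⟩
  have hpos : 0 < w i := by
    refine (hw'.1 i).lt_of_ne' fun hwi => ?_
    have hvi : v i = 0 := le_antisymm (hwi ▸ hle i) (hv'.1 i)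
    have h1 := h.grad_anti hle (hvi.trans hwi.symm)
    have h2 := h.grad_nonneg hw hi
    rcases hS i hi with h3 | h3
    · exact h3.1.ne' hvi
    · linarith
  exact ⟨hpos, h.grad_eq_zero hw hpos⟩

/-! ### Accuracy of the iterates -/

/-- A posteriori bound: on `S` the strong convexity term absorbs the gradient at the price of its
square, and off `S` the gradient has the favourable sign. -/
theorem gap_le (h : IsMQuadratic Q α L g) {S : Finset (Fin n)} {x w u : E n} (hx : x ∈ face S)
    (hx' : ∀ i ∉ S, 0 ≤ gradient g x i) (hw : ∀ i ∈ S, gradient g w i = 0) (hu : ∀ i, 0 ≤ u i) :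
    g x - g u ≤ L ^ 2 * ‖x - w‖ ^ 2 / (2 * α) := by
  have hα := h.pos
  have h1 := h.low x u
  have h2 : ∑ i, -((gradient g x - gradient g w) i ^ 2 / (2 * α))
      ≤ ∑ i, (gradient g x i * (u - x) i + α / 2 * (u - x) i ^ 2) := by
    refine Finset.sum_le_sum fun i _ => ?_
    by_cases hi : i ∈ S
    · rw [PiLp.sub_apply, hw i hi, sub_zero]
      have : gradient g x i * (u - x) i + α / 2 * (u - x) i ^ 2
          = -(gradient g x i ^ 2 / (2 * α)) + (gradient g x i + α * (u - x) i) ^ 2 / (2 * α) := by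
        field_simp; ring
      rw [this]
      have : 0 ≤ (gradient g x i + α * (u - x) i) ^ 2 / (2 * α) := by positivity
      linarith
    · have hxi := (mem_face.1 hx).2 i hi
      have h3 : 0 ≤ (u - x) i := by rw [PiLp.sub_apply, hxi, sub_zero]; exact hu i
      have h4 := mul_nonneg (hx' i hi) h3
      have h5 : 0 ≤ (gradient g x - gradient g w) i ^ 2 / (2 * α) := by positivity
      have h6 : 0 ≤ α / 2 * (u - x) i ^ 2 := by positivity
      linarith
  rw [Finset.sum_neg_distrib, ← Finset.sum_div, ← EuclideanSpace.real_norm_sq_eq,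
    Finset.sum_add_distrib, ← inner_eq_sum, ← Finset.mul_sum, ← EuclideanSpace.real_norm_sq_eq] at h2
  have h3 : ‖gradient g x - gradient g w‖ ^ 2 / (2 * α) ≤ L ^ 2 * ‖x - w‖ ^ 2 / (2 * α) := by
    rw [← mul_pow]
    gcongr
    exact h.lipschitz w x
  linarith

end IsMQuadratic

section Step

variable {n : ℕ} {Q : Matrix (Fin n) (Fin n) ℝ} {α L ε : ℝ} {g : E n → ℝ}

theorem delta_sq (hα : 0 < α) (hε : 0 < ε) (S : Finset (Fin n)) :
    delta α L ε S ^ 2 = ε * α / ((1 + (S.card : ℝ)) * L ^ 2) :=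
  Real.sq_sqrt (by positivity)

theorem delta_pos (hα : 0 < α) (hL : 0 < L) (hε : 0 < ε) (S : Finset (Fin n)) :
    0 < delta α L ε S :=
  Real.sqrt_pos.2 (by positivity)

namespace IsMQuadratic

/-- Stationarity of `w` on `S` turns the distance to `w` into the gradient restricted to `S`, which
is the computable quantity that determines the number of inner iterations. -/
theorem sq_mul_norm_sq_le (h : IsMQuadratic Q α L g) {S : Finset (Fin n)} {x w : E n}
    (hx : x ∈ face S) (hw : w ∈ face S) (hw' : ∀ i ∈ S, gradient g w i = 0) :
    α ^ 2 * ‖x - w‖ ^ 2 ≤ ∑ i ∈ S, gradient g x i ^ 2 := by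
  have h1 := h.grad_strongly_mono w x
  have h2 : ⟪gradient g x - gradient g w, x - w⟫ = ∑ i ∈ S, gradient g x i * (x - w) i := by
    rw [inner_eq_sum, ← Finset.sum_subset (Finset.subset_univ S)]
    · refine Finset.sum_congr rfl fun i hi => ?_
      rw [PiLp.sub_apply, hw' i hi, sub_zero]
    · intro i _ hi
      simp [(mem_face.1 hx).2 i hi, (mem_face.1 hw).2 i hi]
  have h3 : ∑ i ∈ S, (x - w) i ^ 2 ≤ ‖x - w‖ ^ 2 := by
    rw [EuclideanSpace.real_norm_sq_eq]
    exact Finset.sum_le_sum_of_subset_of_nonneg (Finset.subset_univ S) fun _ _ _ => sq_nonneg _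
  have h4 := Finset.sum_mul_sq_le_sq_mul_sq S (fun i => gradient g x i) (fun i => (x - w) i)
  rw [h2] at h1
  have h5 : 0 ≤ ∑ i ∈ S, gradient g x i ^ 2 := Finset.sum_nonneg fun _ _ => sq_nonneg _
  rcases (sq_nonneg ‖x - w‖).eq_or_lt with h0 | h0
  · rw [← h0, mul_zero]; exact h5
  refine le_of_mul_le_mul_right ?_ h0
  calc α ^ 2 * ‖x - w‖ ^ 2 * ‖x - w‖ ^ 2 = (α * ‖x - w‖ ^ 2) ^ 2 := by ring
    _ ≤ (∑ i ∈ S, gradient g x i * (x - w) i) ^ 2 :=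
      pow_le_pow_left₀ (mul_nonneg h.pos.le h0.le) h1 2
    _ ≤ _ := h4.trans (mul_le_mul_of_nonneg_left h3 h5)

/-- The number of inner iterations is large enough for the inner solution to be within `delta` of
the minimizer over the face. -/
theorem apgd_numIter (h : IsMQuadratic Q α L g) (hε : 0 < ε) {S : Finset (Fin n)} {x w : E n}
    (hx : x ∈ face S) (hw : IsArgminOn g (face S) w) (hw' : ∀ i ∈ S, gradient g w i = 0) :
    apgd (face S) x g α L (numIter g α L ε x S) ∈ face S ∧
      ‖apgd (face S) x g α L (numIter g α L ε x S) - w‖ ≤ delta α L ε S := by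
  have hα := h.pos
  have hL := hα.trans_le h.le
  have hδ := delta_pos hα hL hε S
  have hε' : 0 < epsHat α L ε S := by unfold epsHat; positivity
  have hκ : 0 < √(L / α) := Real.sqrt_pos.2 (by positivity)
  set R := (L - α) * (∑ i ∈ S, gradient g x i ^ 2) / (2 * epsHat α L ε S * α ^ 2) with hR
  have hR0 : 0 ≤ R := div_nonneg (mul_nonneg (by linarith [h.le])
    (Finset.sum_nonneg fun _ _ => sq_nonneg _)) (by positivity)
  set N := ⌈2 * √(L / α) * Real.log R⌉₊ with hN
  have hnum : numIter g α L ε x S = N + 1 := add_comm _ _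
  rw [hnum]
  obtain ⟨hy, hacc⟩ := apgd_accuracy hα h.le isClosed_face convex_face h.low h.up hx hw.1 N
  refine ⟨hy, ?_⟩
  set y := apgd (face S) x g α L (N + 1)
  -- when `R = 0` this is trivial, so the junk value of the logarithm is harmless
  have hRN : R ≤ Real.exp (N / (2 * √(L / α))) := by
    rcases hR0.eq_or_lt with h0 | h0
    · rw [← h0]; positivity
    · rw [← Real.log_le_iff_le_exp h0, le_div_iff₀ (by positivity), mul_comm]
      exact Nat.le_ceil _
  have h1 : (L - α) / 2 * ‖x - w‖ ^ 2 ≤ R * epsHat α L ε S := by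
    have h2 := mul_le_mul_of_nonneg_left (h.sq_mul_norm_sq_le hx hw.1 hw')
      (sub_nonneg.2 h.le)
    have h3 : R * epsHat α L ε S = (L - α) * (∑ i ∈ S, gradient g x i ^ 2) / (2 * α ^ 2) := by
      rw [hR]; field_simp
    rw [h3, le_div_iff₀ (by positivity)]
    linarith
  have h4 : g y - g w ≤ epsHat α L ε S := by
    refine le_of_mul_le_mul_left (hacc.trans (h1.trans ?_)) (Real.exp_pos _)
    exact mul_le_mul_of_nonneg_right hRN hε'.le
  have h5 := (h.argmin_gap convex_face hw hy).trans h4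
  refine abs_le_of_sq_le_sq' ?_ hδ.le |>.2
  unfold epsHat at h5
  nlinarith

/-- The truncated step stays below the minimizer `w` of the restricted problem and close to it. -/
theorem nextIter_spec (h : IsMQuadratic Q α L g) (hε : 0 < ε) {S : Finset (Fin n)} {x w : E n}
    (hx : x ∈ face S) (hw : IsArgminOn g (face S) w) (hw' : ∀ i ∈ S, gradient g w i = 0) :
    nextIter g α L ε x S ∈ face S ∧ (∀ i, nextIter g α L ε x S i ≤ w i) ∧
      ‖nextIter g α L ε x S - w‖ ^ 2 ≤ 2 * ((1 + S.card) * delta α L ε S ^ 2) := by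
  obtain ⟨hy, hyw⟩ := h.apgd_numIter hε hx hw hw'
  have hδ := delta_pos h.pos (h.pos.trans_le h.le) hε S
  set δ := delta α L ε S with hδ'
  set y := apgd (face S) x g α L (numIter g α L ε x S)
  have hnext : ∀ i, nextIter g α L ε x S i = max 0 (y i - δ) := fun i => rfl
  have hy' := mem_face.1 hy
  have hw0 := mem_face.1 hw.1
  have hi : ∀ i, y i - δ ≤ w i := fun i => by
    have := (PiLp.norm_apply_le (y - w) i).trans hyw
    have := (abs_le.1 this).2
    rw [PiLp.sub_apply] at this
    linarith
  have hle : ∀ i, nextIter g α L ε x S i ≤ w i := fun i => by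
    rw [hnext]; exact max_le (hw0.1 i) (hi i)
  have hoff : ∀ i ∉ S, nextIter g α L ε x S i = 0 := fun i hiS => by
    rw [hnext, hy'.2 i hiS, max_eq_left]; linarith
  refine ⟨mem_face.2 ⟨fun i => (hnext i).symm ▸ le_max_left _ _, hoff⟩, hle, ?_⟩
  calc ‖nextIter g α L ε x S - w‖ ^ 2
      = ∑ i, (nextIter g α L ε x S - w) i ^ 2 := EuclideanSpace.real_norm_sq_eq _
    _ = ∑ i ∈ S, (nextIter g α L ε x S - w) i ^ 2 := by
      refine (Finset.sum_subset (Finset.subset_univ S) fun i _ hiS => ?_).symm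
      simp [hoff i hiS, hw0.2 i hiS]
    _ ≤ ∑ i ∈ S, (2 * (y - w) i ^ 2 + 2 * δ ^ 2) := by
      refine Finset.sum_le_sum fun i _ => ?_
      have h1 : 0 ≤ w i - nextIter g α L ε x S i := sub_nonneg.2 (hle i)
      have h2 : w i - nextIter g α L ε x S i ≤ w i - y i + δ := by
        have := le_max_right 0 (y i - δ)
        rw [hnext]
        linarith
      have h3 := pow_le_pow_left₀ h1 h2 2
      rw [PiLp.sub_apply, PiLp.sub_apply]
      nlinarith [sq_nonneg (w i - y i - δ)]
    _ = 2 * ∑ i ∈ S, (y - w) i ^ 2 + S.card * (2 * δ ^ 2) := by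
      rw [Finset.sum_add_distrib, ← Finset.mul_sum, Finset.sum_const, nsmul_eq_mul]
    _ ≤ 2 * δ ^ 2 + S.card * (2 * δ ^ 2) := by
      have h1 : ∑ i ∈ S, (y - w) i ^ 2 ≤ ‖y - w‖ ^ 2 := by
        rw [EuclideanSpace.real_norm_sq_eq]
        exact Finset.sum_le_sum_of_subset_of_nonneg (Finset.subset_univ S)
          fun _ _ _ => sq_nonneg _
      have h2 := pow_le_pow_left₀ (norm_nonneg _) hyw 2
      linarith
    _ = _ := by ring

end IsMQuadratic
end Step

/-! ### The outer loop -/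

section Run

variable {n : ℕ} {Q : Matrix (Fin n) (Fin n) ℝ} {α L ε : ℝ} {g : E n → ℝ}

theorem known_eq (t : ℕ) :
    known g α L ε t = knownPrev g α L ε t ∪ negCoords g (iter g α L ε t) := by
  cases t
  · exact (Finset.empty_union _).symm
  · rfl

theorem knownPrev_subset (t : ℕ) : knownPrev g α L ε t ⊆ known g α L ε t := by
  rw [known_eq]; exact Finset.subset_union_left

/-- The index sets strictly grow inside `Fin n` until the loop stops. -/
theorem exists_known_eq_knownPrev (g : E n → ℝ) (α L ε : ℝ) :
    ∃ t, known g α L ε t = knownPrev g α L ε t := by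
  by_contra! hne
  have hcard : ∀ t, t ≤ (knownPrev g α L ε t).card := by
    intro t
    induction t with
    | zero => exact Nat.zero_le _
    | succ t ih =>
      exact ih.trans_lt (Finset.card_lt_card ((knownPrev_subset t).ssubset_of_ne (hne t).symm))
  have h1 := hcard (n + 1)
  have h2 := Finset.card_le_univ (knownPrev g α L ε (n + 1))
  rw [Fintype.card_fin] at h2
  omega

namespace IsMQuadratic

/-- The invariant of the outer loop. The last clause says that stopping certifies optimality: if
the gradient at `x^{(t)}` is nonnegative off `S^{(t-1)}`, then `x^{(t)}` is an `ε`-minimizer. -/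
structure RunInvariant (g : E n → ℝ) (α L ε : ℝ) (t : ℕ) : Prop where
  iter_mem : iter g α L ε t ∈ face (knownPrev g α L ε t)
  argmin : IsArgminOn g (face (knownPrev g α L ε t)) (restrMin g α L ε t)
  pos : ∀ i ∈ knownPrev g α L ε t, 0 < restrMin g α L ε t i
  grad : ∀ i ∈ knownPrev g α L ε t, gradient g (restrMin g α L ε t) i = 0
  iter_le : ∀ i, iter g α L ε t i ≤ restrMin g α L ε t i
  eps : (∀ i ∉ knownPrev g α L ε t, 0 ≤ gradient g (iter g α L ε t) i) →
    IsEpsMinOn g (orthant n) ε (iter g α L ε t)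

/-- At the restricted minimizer the gradient is nonpositive on all indices found so far, and
negative on the newly found ones, where `x^{(t)}` and the restricted minimizer both vanish. -/
theorem RunInvariant.subsolution (h : IsMQuadratic Q α L g) {t : ℕ}
    (ht : RunInvariant g α L ε t) {i : Fin n} (hi : i ∈ known g α L ε t) :
    0 < restrMin g α L ε t i ∧ gradient g (restrMin g α L ε t) i ≤ 0 ∨
      gradient g (restrMin g α L ε t) i < 0 := by
  by_cases hi' : i ∈ knownPrev g α L ε t
  · exact Or.inl ⟨ht.pos i hi', (ht.grad i hi').le⟩
  · rw [known_eq, Finset.mem_union] at hi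
    have hneg : gradient g (iter g α L ε t) i < 0 :=
      (Finset.mem_filter.1 (hi.resolve_left hi')).2
    have heq : iter g α L ε t i = restrMin g α L ε t i :=
      ((mem_face.1 ht.iter_mem).2 i hi').trans ((mem_face.1 ht.argmin.1).2 i hi').symm
    exact Or.inr ((h.grad_anti ht.iter_le heq).trans_lt hneg)

/-- One step enlarges the restricted minimizer, which becomes positive and stationary on all known
indices. -/
theorem RunInvariant.step (h : IsMQuadratic Q α L g) {t : ℕ} (ht : RunInvariant g α L ε t) :
    (∀ i, restrMin g α L ε t i ≤ restrMin g α L ε (t + 1) i) ∧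
      ∀ i ∈ known g α L ε t, 0 < restrMin g α L ε (t + 1) i ∧
        gradient g (restrMin g α L ε (t + 1)) i = 0 :=
  h.argmin_face_of_subsolution (face_mono (knownPrev_subset t) ht.argmin.1)
    (fun _ hi => ht.subsolution h hi) (h.isArgminOn_argminOn _)

theorem runInvariant (h : IsMQuadratic Q α L g) (hε : 0 < ε) (t : ℕ) :
    RunInvariant g α L ε t := by
  induction t with
  | zero =>
    have h0 : ∀ y ∈ face (∅ : Finset (Fin n)), y = 0 := fun y hy => by
      ext i; exact (mem_face.1 hy).2 i (Finset.notMem_empty i)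
    refine ⟨zero_mem_face, ⟨zero_mem_face, fun y hy => by rw [h0 y hy]; rfl⟩,
      fun i hi => absurd hi (Finset.notMem_empty i), fun i hi => absurd hi (Finset.notMem_empty i),
      fun _ => le_rfl, fun hg => ⟨fun _ => le_rfl, fun u hu => ?_⟩⟩
    have h1 := h.gap_le (S := ∅) (x := 0) (w := 0) (u := u) zero_mem_face hg
      (fun i hi => absurd hi (Finset.notMem_empty i)) hu
    rw [sub_zero, norm_zero] at h1
    have h2 : L ^ 2 * (0 : ℝ) ^ 2 / (2 * α) = 0 := by ring
    exact (h1.trans h2.le).trans hε.le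
  | succ t ih =>
    obtain ⟨-, hpos⟩ := ih.step h
    have hw := h.isArgminOn_argminOn (known g α L ε t)
    obtain ⟨hmem, hle, hdist⟩ := h.nextIter_spec hε (face_mono (knownPrev_subset t) ih.iter_mem) hw
      (fun i hi => (hpos i hi).2)
    refine ⟨hmem, hw, fun i hi => (hpos i hi).1, fun i hi => (hpos i hi).2, hle,
      fun hg => ⟨(mem_face.1 hmem).1, fun u hu => ?_⟩⟩
    refine (h.gap_le hmem hg (fun i hi => (hpos i hi).2) hu).trans ?_
    have hα := h.pos
    have hL := hα.trans_le h.le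
    rw [delta_sq hα hε] at hdist
    have h1 : 2 * ((1 + ((known g α L ε t).card : ℝ)) *
        (ε * α / ((1 + ((known g α L ε t).card : ℝ)) * L ^ 2))) = 2 * (ε * α / L ^ 2) := by
      field_simp
    rw [h1] at hdist
    rw [div_le_iff₀ (by positivity)]
    calc _ ≤ L ^ 2 * (2 * (ε * α / L ^ 2)) := mul_le_mul_of_nonneg_left hdist (sq_nonneg _)
      _ = ε * (2 * α) := by field_simp

theorem RunInvariant.le_argmin (h : IsMQuadratic Q α L g) {t : ℕ} (ht : RunInvariant g α L ε t)
    {w : E n} (hw : IsArgminOn g (orthant n) w) (i : Fin n) : restrMin g α L ε t i ≤ w i := by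
  rw [← face_univ] at hw
  exact h.le_of_grad (mem_face.1 hw.1).1
    (fun i hi => (h.grad_eq_zero ht.argmin hi).le)
    (fun i _ => h.grad_nonneg hw (Finset.mem_univ i)) i

theorem RunInvariant.known_subset_supp (h : IsMQuadratic Q α L g) {t : ℕ}
    (ht : RunInvariant g α L ε t) {w : E n} (hw : IsArgminOn g (orthant n) w) :
    known g α L ε t ⊆ supp w := by
  intro i hi
  refine Finset.mem_filter.2 ⟨Finset.mem_univ i, fun hwi => ?_⟩
  have hle := ht.le_argmin h hw
  have h0 := (mem_face.1 ht.argmin.1).1 i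
  rcases ht.subsolution h hi with h1 | h1
  · linarith [h1.1, hle i]
  · have h2 := h.grad_anti hle (i := i) (by linarith [hle i])
    rw [← face_univ] at hw
    linarith [h.grad_nonneg hw (Finset.mem_univ i)]

theorem RunInvariant.eps_of_eq {t : ℕ} (ht : RunInvariant g α L ε t)
    (heq : known g α L ε t = knownPrev g α L ε t) :
    IsEpsMinOn g (orthant n) ε (iter g α L ε t) := by
  refine ht.eps fun i hi => ?_
  rw [← heq, known_eq, Finset.mem_union, not_or] at hi
  exact not_lt.1 fun hneg => hi.2 (Finset.mem_filter.2 ⟨Finset.mem_univ i, hneg⟩)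

end IsMQuadratic
end Run

end ASPR

theorem mainTheorem1 (n : ℕ) (Q : Matrix (Fin n) (Fin n) ℝ) (b : ASPR.E n) (c α L ε : ℝ)
    (hQ : Q.PosDef) (hM : ∀ i j, i ≠ j → Q i j ≤ 0)
    (hα : 0 < α) (hαQ : (Q - α • (1 : Matrix (Fin n) (Fin n) ℝ)).PosSemidef)
    (hLQ : (L • (1 : Matrix (Fin n) (Fin n) ℝ) - Q).PosSemidef)
    (hε : 0 < ε)
    (g : ASPR.E n → ℝ) (hg : g = ASPR.quad Q b c)
    (xast : ASPR.E n) (hxast : xast = ASPR.argminOn g (ASPR.orthant n))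
    (x xs xsPrev : ℕ → ASPR.E n) (hx : x = ASPR.iter g α L ε)
    (hxs : xs = ASPR.restrMin g α L ε) (hxsPrev : xsPrev = ASPR.restrMinPrev g α L ε)
    (S SPrev : ℕ → Finset (Fin n)) (hS : S = ASPR.known g α L ε)
    (hSPrev : SPrev = ASPR.knownPrev g α L ε) :
    -- `xast` is the unique minimizer over the nonnegative orthant
    (∀ y, ASPR.IsArgminOn g (ASPR.orthant n) y ↔ y = xast) ∧
    -- the algorithm stops, after a first stage `T` at which the index set is unchanged
    ∃ T : ℕ, IsLeast {t : ℕ | S t = SPrev t} T ∧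
      (∀ t ≤ T,
        -- `xs t` is the unique minimizer over the cone of `SPrev t`
        (∀ y, ASPR.IsArgminOn g (ASPR.face (SPrev t)) y ↔ y = xs t) ∧
        (∀ i, 0 < xs t i ↔ i ∈ SPrev t) ∧
        (∀ i ∈ SPrev t, gradient g (xs t) i = 0) ∧
        (∀ i, x t i ≤ xs t i) ∧
        (∀ i, xs t i ≤ xast i) ∧
        (∀ i, xsPrev t i ≤ xs t i) ∧
        S t ⊆ ASPR.supp xast ∧
        (SPrev t ⊂ S t ∨ ASPR.IsEpsMinOn g (ASPR.orthant n) ε (x t))) ∧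
      ASPR.IsEpsMinOn g (ASPR.orthant n) ε (x T) ∧
      g (x T) - g xast ≤ ε := by
  classical
  open ASPR in
  have hfind := Nat.find_spec (exists_known_eq_knownPrev g α L ε)
  have hleast : IsLeast {t : ℕ | known g α L ε t = knownPrev g α L ε t}
      (Nat.find (exists_known_eq_knownPrev g α L ε)) :=
    ⟨hfind, fun t ht => Nat.find_min' _ ht⟩
  subst hx hxs hxsPrev hS hSPrev
  rcases Nat.eq_zero_or_pos n with rfl | hn
  · -- `ℝ⁰` is a single point; here `α ≤ L` need not hold
    have harg : ∀ (C : Set (E 0)) (y : E 0), y ∈ C → ∀ z, IsArgminOn g C y ↔ y = z :=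
      fun C y hy z => ⟨fun _ => Subsingleton.elim _ _,
        fun _ => ⟨hy, fun u _ => (congrArg g (Subsingleton.elim y u)).le⟩⟩
    have heps : ∀ y, IsEpsMinOn g (orthant 0) ε y := fun y => ⟨fun i => i.elim0, fun u _ => by
      rw [Subsingleton.elim y u, sub_self]; exact hε.le⟩
    refine ⟨fun y => harg _ _ (fun i => i.elim0) _, _, hleast, fun t _ =>
      ⟨fun y => harg _ _ (Subsingleton.elim 0 y ▸ zero_mem_face) _, fun i => i.elim0,
        fun i => i.elim0, fun i => i.elim0, fun i => i.elim0, fun i => i.elim0, fun i => i.elim0,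
        Or.inr (heps _)⟩, heps _, (heps _).2 _ fun i => i.elim0⟩
  have : NeZero n := ⟨hn.ne'⟩
  have h : IsMQuadratic Q α L g := hg ▸ isMQuadratic_quad hQ hM hα hαQ hLQ b c
  have hast : IsArgminOn g (orthant n) xast := by
    rw [hxast, ← face_univ]; exact h.isArgminOn_argminOn _
  have hinv := h.runInvariant hε
  have hend := (hinv _).eps_of_eq hfind
  refine ⟨h.isArgminOn_iff (face_univ (n := n) ▸ convex_face) hast, _, hleast, fun t _ => ?_, hend,
    hend.2 _ hast.1⟩
  have ht := hinv t
  refine ⟨h.isArgminOn_iff convex_face ht.argmin, fun i => ⟨fun hi => ?_, ht.pos i⟩, ht.grad,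
    ht.iter_le, ht.le_argmin h hast, ?_, ht.known_subset_supp h hast, ?_⟩
  · by_contra hiS
    exact hi.ne' ((mem_face.1 ht.argmin.1).2 i hiS)
  · cases t with
    | zero => exact fun _ => le_rfl
    | succ t => exact ((hinv t).step h).1
  · by_cases heq : known g α L ε t = knownPrev g α L ε t
    · exact Or.inr (ht.eps_of_eq heq)
    · exact Or.inl ((knownPrev_subset t).ssubset_of_ne (Ne.symm heq))
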